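/- Let $\mathbb D^2$ be the unit bidisc, $\mathbf s(z_1,z_2)=(z_1+z_2,\,z_1z_2)$ the symmetrization map, $\mathbb G_2=\mathbf s(\mathbb D^2)\subset\mathbb C^2$ the symmetrized bidisc, and $J_{\mathbf s}(z_1,z_2)=z_1-z_2$ the complex Jacobian of $\mathbf s$. Let $dV=\pi^{-2}\prod_{i=1}^2 r_i\,dr_i\,d\theta_i$ be the normalized Lebesgue measure on $\mathbb D^2$, and let $dV_{\mathbf s}$ be the measure on $\mathbb G_2$ given by $$\int_{\mathbb G_2} f\,dV_{\mathbf s}=\|J_{\mathbf s}\|^{-2}\int_{\mathbb D^2}(f\circ\mathbf s)\,|J_{\mathbf s}|^2\,dV,\qquad \|J_{\mathbf s}\|^2=\int_{\mathbb D^2}|J_{\mathbf s}|^2\,dV,$$ so that $dV_{\mathbf s}$ is the Lebesgue measure on $\mathbb G_2$ normalized to total mass $1$. Let $\mathbb A^{(2)}(\mathbb G_2)$ be the Bergman space of holomorphic functions in $L^2(\mathbb G_2,dV_{\mathbf s})$ (the case $n=2$, $\lambda=2$ of the weighted Bergman spaces $\mathbb A^{(\lambda)}(\mathbb G_n)$).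 Then $\mathbb A^{(2)}(\mathbb G_2)$ has a unique reproducing kernel $\mathbf B^{(2)}_{\mathbb G_2}$, the Bergman kernel of the symmetrized bidisc, that is, a unique function on $\mathbb G_2\times\mathbb G_2$ such that for every $v\in\mathbb G_2$ the function $\mathbf B^{(2)}_{\mathbb G_2}(\cdot,v)$ lies in $\mathbb A^{(2)}(\mathbb G_2)$ and $\langle f,\mathbf B^{(2)}_{\mathbb G_2}(\cdot,v)\rangle=f(v)$ for all $f\in\mathbb A^{(2)}(\mathbb G_2)$. It is given by $$\mathbf B^{(2)}_{\mathbb G_2}(u,v)=\frac12\cdot\frac{2(1+u_2\bar v_2)-u_1\bar v_1}{\big((1-u_2\bar v_2)^2-(u_1-u_2\bar v_1)(\bar v_1-\bar v_2u_1)\big)^2},\qquad u=(u_1,u_2),\ v=(v_1,v_2)\in\mathbb G_2,$$ where the denominator does not vanish. -/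

import Mathlib

open MeasureTheory
open scoped ENNReal ComplexConjugate

namespace SymPolydisc

noncomputable section

/-- The open unit polydisc `{z ∈ ℂⁿ : ‖z‖_∞ < 1}` (the norm of `Fin n → ℂ` is the sup norm). -/
def polydisc (n : ℕ) : Set (Fin n → ℂ) := Metric.ball 0 1

/-- The symmetrization map `s(z) = (φ₁(z), …, φₙ(z))`, where `φᵢ` is the elementary symmetric
polynomial of degree `i`. The coordinate with index `i : Fin n` is `φ_{i+1}`. -/
def symmetrization (n : ℕ) (z : Fin n → ℂ) : Fin n → ℂ :=
  fun i => MvPolynomial.eval z (MvPolynomial.esymm (Fin n) ℂ ((i : ℕ) + 1))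

/-- The symmetrized polydisc `𝔾ₙ = s(𝔻ⁿ)`. -/
def symPolydisc (n : ℕ) : Set (Fin n → ℂ) := symmetrization n '' polydisc n

/-- The complex Jacobian `J_s(z) = ∏_{i < j} (z_i - z_j)` of the symmetrization map. -/
def jacobian (n : ℕ) (z : Fin n → ℂ) : ℂ :=
  ∏ i : Fin n, ∏ j ∈ Finset.Ioi i, (z i - z j)

/-- The probability measure
`dV^(lam) = ((lam - 1) / π)ⁿ ∏ᵢ (1 - |zᵢ|²)^(lam - 2) dA(zᵢ)` on the polydisc, for `lam > 1`,
where `dA = r dr dθ` is Lebesgue measure on `ℂ`. -/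
def polydiscMeasure (n : ℕ) (lam : ℝ) : Measure (Fin n → ℂ) :=
  ((volume : Measure (Fin n → ℂ)).restrict (polydisc n)).withDensity fun z =>
    ENNReal.ofReal (((lam - 1) / Real.pi) ^ n * ∏ i, (1 - ‖z i‖ ^ 2) ^ (lam - 2))

/-- The squared norm `‖J_s‖²_lam = ∫ |J_s|² dV^(lam)`. -/
def jacobianNormSq (n : ℕ) (lam : ℝ) : ℝ≥0∞ :=
  ∫⁻ z, ‖jacobian n z‖ₑ ^ 2 ∂(polydiscMeasure n lam)

/-- The normalized measure `dV_s^(lam)` on the symmetrized polydisc: the image under `s` of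
`|J_s|² dV^(lam)`, that is
`∫ f dV_s^(lam) = ‖J_s‖_lam⁻² ∫_{𝔻ⁿ} (f ∘ s) |J_s|² dV^(lam)`, so that `‖1‖ = 1`. -/
def symMeasure (n : ℕ) (lam : ℝ) : Measure (Fin n → ℂ) :=
  (jacobianNormSq n lam)⁻¹ •
    ((polydiscMeasure n lam).withDensity fun z => ‖jacobian n z‖ₑ ^ 2).map (symmetrization n)

/-- The weighted Bergman space `𝔸^(lam)(𝔾ₙ)`: the functions that are holomorphic on `𝔾ₙ` and
square integrable with respect to `dV_s^(lam)`, a measure carried by `𝔾ₙ`. Elements are written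
as functions on `ℂⁿ`, of which only the restriction to `𝔾ₙ` matters. -/
def weightedBergman (n : ℕ) (lam : ℝ) : Set ((Fin n → ℂ) → ℂ) :=
  {f | DifferentiableOn ℂ f (symPolydisc n) ∧ MemLp f 2 (symMeasure n lam)}

/-- `K` is (on `𝔾ₙ × 𝔾ₙ`) the reproducing kernel of `𝔸^(lam)(𝔾ₙ)`: for every `v ∈ 𝔾ₙ` the
function `K(·, v)` belongs to the space and `⟨f, K(·, v)⟩ = f(v)` for all `f` in the space. -/
def IsBergmanKernel (n : ℕ) (lam : ℝ) (K : (Fin n → ℂ) → (Fin n → ℂ) → ℂ) : Prop :=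
  ∀ v ∈ symPolydisc n,
    (fun u => K u v) ∈ weightedBergman n lam ∧
    ∀ f ∈ weightedBergman n lam, ∫ u, f u * conj (K u v) ∂(symMeasure n lam) = f v

end

end SymPolydisc

open scoped Topology

namespace SymPolydisc


/-! The map f ↦ (f ∘ s)·J, with J = z₀ - z₁, carries the Bergman space of 𝔾₂ isometrically to
antisymmetric Bergman functions on the bidisc (‖J‖ = 1 here). Antisymmetrizing the bidisc kernel k
gives (k(z, w) - k(z, w'))/2, where w' is w with its coordinates swapped, and it reproduces such
functions. Dividing by J(z)·conj J(w) yields the kernel of 𝔾₂.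

The closed form comes from a difference of squares. With a, b, c, d the four factors 1 - conj(zᵢ)wⱼ,
ordered 00, 01, 10, 11, one has 1/(ad)² - 1/(bc)² = (bc - ad)(bc + ad)/(abcd)². Here bc - ad is
exactly the Jacobian product (`jacobian_mul_conj_symKernel`); up to conjugation, ad + bc and abcd
are the numerator and the base of the squared denominator.

The reproducing property of k is proved by hand: polar coordinates and Cauchy's formula on the disc
(`setIntegral_ball_div_sq`), then Fubini (`setIntegral_ball_prod_ball`). Points with J(w) = 0 are
reached by continuity (`integral_kernel`). Uniqueness is the usual pairing of two kernels
(`IsBergmanKernel.eq_conj`). -/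

/-! ### The Bergman kernel of the unit disc -/

theorem one_sub_conj_mul_ne_zero {z w : ℂ} (hz : ‖z‖ < 1) (hw : ‖w‖ < 1) :
    1 - conj z * w ≠ 0 := by
  intro h
  have h1 : ‖conj z * w‖ = 1 := by rw [← sub_eq_zero.mp h, norm_one]
  rw [norm_mul, RCLike.norm_conj] at h1
  nlinarith [norm_nonneg z, norm_nonneg w]

/-- On |z| = r one has conj z = r²/z, so 1 - conj(z)w = (z - r²w)/z. The integral becomes Cauchy's
formula for the derivative of z·g(z) at r²w. -/
theorem intervalIntegral_circleMap_div_sq {g : ℂ → ℂ} (hg : DifferentiableOn ℂ g (Metric.ball 0 1))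
    {w : ℂ} (hw : ‖w‖ < 1) {r : ℝ} (h0 : 0 < r) (h1 : r < 1) :
    ∫ θ in (-Real.pi)..Real.pi, g (circleMap 0 r θ) / (1 - conj (circleMap 0 r θ) * w) ^ 2 =
      2 * Real.pi * (g (r ^ 2 * w) + r ^ 2 * w * deriv g (r ^ 2 * w)) := by
  have hsub : Metric.closedBall (0 : ℂ) r ⊆ Metric.ball 0 1 := Metric.closedBall_subset_ball h1
  have hmem : (r ^ 2 * w : ℂ) ∈ Metric.ball (0 : ℂ) r := by
    rw [mem_ball_zero_iff, norm_mul, norm_pow, Complex.norm_real, Real.norm_of_nonneg h0.le]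
    have : r * ‖w‖ < 1 := by nlinarith [norm_nonneg w]
    nlinarith
  have hmem' : (r ^ 2 * w : ℂ) ∈ Metric.ball (0 : ℂ) 1 := hsub (Metric.ball_subset_closedBall hmem)
  have key := Complex.two_pi_I_inv_smul_circleIntegral_sub_sq_inv_smul_of_differentiable
    Metric.isOpen_ball hsub (differentiableOn_id.mul hg) hmem
  have hd : deriv (id * g) (r ^ 2 * w) = g (r ^ 2 * w) + r ^ 2 * w * deriv g (r ^ 2 * w) := by
    have := (hasDerivAt_id (r ^ 2 * w : ℂ)).mul
      ((hg.differentiableAt (Metric.isOpen_ball.mem_nhds hmem')).hasDerivAt)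
    rw [this.deriv]; simp
  rw [hd, circleIntegral, inv_smul_eq_iff₀ (by simp [Real.pi_ne_zero])] at key
  have hper : Function.Periodic
      (fun θ => g (circleMap 0 r θ) / (1 - conj (circleMap 0 r θ) * w) ^ 2) (2 * Real.pi) := by
    intro θ
    simp only [periodic_circleMap 0 r θ]
  -- Polar coordinates use angles in (-π, π), circle integrals use (0, 2π).
  have hshift := hper.intervalIntegral_add_eq (-Real.pi) 0
  rw [show -Real.pi + 2 * Real.pi = Real.pi by ring, zero_add] at hshift
  rw [hshift]
  have hI : ∫ θ in (0 : ℝ)..2 * Real.pi, deriv (circleMap 0 r) θ •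
        ((circleMap 0 r θ - r ^ 2 * w) ^ 2)⁻¹ • ((id : ℂ → ℂ) * g) (circleMap 0 r θ) =
      Complex.I * ∫ θ in (0 : ℝ)..2 * Real.pi,
        g (circleMap 0 r θ) / (1 - conj (circleMap 0 r θ) * w) ^ 2 := by
    rw [← intervalIntegral.integral_const_mul]
    refine intervalIntegral.integral_congr fun θ _ => ?_
    set z := circleMap 0 r θ with hz
    have hzn : ‖z‖ = r := by rw [hz, norm_circleMap_zero, abs_of_pos h0]
    have hz0 : z ≠ 0 := by rw [← norm_pos_iff, hzn]; exact h0
    have hden := one_sub_conj_mul_ne_zero (hzn.trans_lt h1) hw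
    have hzz : z * conj z = r ^ 2 := by rw [Complex.mul_conj, Complex.normSq_eq_norm_sq, hzn]; simp
    have e : z - r ^ 2 * w = z * (1 - conj z * w) := by rw [← hzz]; ring
    simp only [deriv_circleMap, smul_eq_mul, Pi.mul_apply, id, ← hz, e]
    field_simp
  rw [hI] at key
  refine mul_left_cancel₀ Complex.I_ne_zero (key.trans ?_)
  simp only [smul_eq_mul]; ring

/-- Integration in polar coordinates over the unit disc. -/
theorem setIntegral_ball_eq_polar {f : ℂ → ℂ} (hf : ContinuousOn f (Metric.ball 0 1))
    (hi : IntegrableOn f (Metric.ball 0 1)) :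
    IntegrableOn (fun r : ℝ => (r : ℂ) * ∫ θ in (-Real.pi)..Real.pi, f (circleMap 0 r θ))
        (Set.Ioo 0 1) ∧
      ∫ z in Metric.ball 0 1, f z =
        ∫ r : ℝ in Set.Ioo 0 1, (r : ℂ) * ∫ θ in (-Real.pi)..Real.pi, f (circleMap 0 r θ) := by
  have hps : ∀ p : ℝ × ℝ, Complex.polarCoord.symm p = circleMap 0 p.1 p.2 := by
    intro p
    rw [Complex.polarCoord_symm_apply, circleMap, zero_add, Complex.exp_mul_I]
    simp
  set S : Set (ℝ × ℝ) := Set.Ioo 0 1 ×ˢ Set.Ioo (-Real.pi) Real.pi with hS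
  have hSm : MeasurableSet S := measurableSet_Ioo.prod measurableSet_Ioo
  have hSsub : S ⊆ polarCoord.target := by
    rintro ⟨r, θ⟩ ⟨⟨h0, _⟩, h⟩
    exact ⟨h0, h⟩
  -- The codomain `E` is general because the identity serves both `f` and its `enorm`.
  have hind : ∀ p ∈ polarCoord.target, ∀ (E : Type) [AddMonoid E] (F : ℂ → E),
      (Metric.ball (0 : ℂ) 1).indicator F (Complex.polarCoord.symm p) =
        S.indicator (fun p => F (circleMap 0 p.1 p.2)) p := by
    rintro ⟨r, θ⟩ ⟨h0, h⟩ E _ F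
    have h0' : (0 : ℝ) < r := h0
    rw [hps]
    by_cases hr : r < 1
    · rw [Set.indicator_of_mem, Set.indicator_of_mem]
      · exact ⟨⟨h0, hr⟩, h⟩
      · simp [abs_of_pos h0', hr]
    · rw [Set.indicator_of_notMem, Set.indicator_of_notMem]
      · exact fun hh => hr hh.1.2
      · simpa [abs_of_pos h0'] using hr
  have hcont : ContinuousOn (fun p : ℝ × ℝ => (p.1 : ℂ) * f (circleMap 0 p.1 p.2)) S := by
    refine (by fun_prop : Continuous fun p : ℝ × ℝ => (p.1 : ℂ)).continuousOn.mul
      (hf.comp (by unfold circleMap; fun_prop) ?_)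
    rintro ⟨r, θ⟩ ⟨⟨h0, h1⟩, _⟩
    simpa [abs_of_pos (show 0 < r from h0)] using h1
  have hint : IntegrableOn (fun p : ℝ × ℝ => (p.1 : ℂ) * f (circleMap 0 p.1 p.2)) S := by
    refine ⟨hcont.aestronglyMeasurable hSm, ?_⟩
    have hfin := hi.2
    rw [HasFiniteIntegral, ← lintegral_indicator Metric.isOpen_ball.measurableSet,
      ← Complex.lintegral_comp_polarCoord_symm] at hfin
    rw [HasFiniteIntegral]
    refine lt_of_le_of_lt ?_ hfin
    rw [← lintegral_indicator hSm, ← lintegral_indicator polarCoord.open_target.measurableSet]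
    refine lintegral_mono fun p => ?_
    by_cases hp : p ∈ polarCoord.target
    · rw [Set.indicator_of_mem hp, hind p hp]
      by_cases hpS : p ∈ S
      · rw [Set.indicator_of_mem hpS, Set.indicator_of_mem hpS, enorm_mul, smul_eq_mul]
        gcongr
        rw [← ofReal_norm, Complex.norm_real, Real.norm_of_nonneg (le_of_lt hpS.1.1)]
      · rw [Set.indicator_of_notMem hpS]; exact zero_le
    · rw [Set.indicator_of_notMem (fun h => hp (hSsub h))]; exact zero_le
  have hint' : Integrable (fun p : ℝ × ℝ => (p.1 : ℂ) * f (circleMap 0 p.1 p.2))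
      ((volume.restrict (Set.Ioo 0 1)).prod (volume.restrict (Set.Ioo (-Real.pi) Real.pi))) := by
    rw [Measure.prod_restrict]; exact hint
  have hinner : ∀ r : ℝ, ∫ θ in Set.Ioo (-Real.pi) Real.pi, (r : ℂ) * f (circleMap 0 r θ) =
      (r : ℂ) * ∫ θ in (-Real.pi)..Real.pi, f (circleMap 0 r θ) := by
    intro r
    rw [integral_const_mul, intervalIntegral.integral_of_le (by linarith [Real.pi_pos]),
      integral_Ioc_eq_integral_Ioo]
  constructor
  · have := hint'.integral_prod_left
    simp only [hinner] at this
    exact this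
  · rw [← integral_indicator Metric.isOpen_ball.measurableSet,
      ← Complex.integral_comp_polarCoord_symm]
    have e1 : ∫ p in polarCoord.target, p.1 • (Metric.ball (0 : ℂ) 1).indicator f
          (Complex.polarCoord.symm p) =
        ∫ p in polarCoord.target, S.indicator
          (fun p : ℝ × ℝ => (p.1 : ℂ) * f (circleMap 0 p.1 p.2)) p := by
      refine setIntegral_congr_fun polarCoord.open_target.measurableSet fun p hp => ?_
      simp only [hind p hp]
      by_cases hpS : p ∈ S <;> simp [hpS]
    rw [e1, setIntegral_indicator hSm, Set.inter_eq_right.mpr hSsub, hS, Measure.volume_eq_prod,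
      setIntegral_prod _ (by rw [← Measure.volume_eq_prod]; exact hint)]
    simp only [hinner]

theorem continuousOn_div_sq {g : ℂ → ℂ} (hg : ContinuousOn g (Metric.ball 0 1))
    {w : ℂ} (hw : ‖w‖ < 1) :
    ContinuousOn (fun z => g z / (1 - conj z * w) ^ 2) (Metric.ball 0 1) :=
  hg.div (by fun_prop) fun z hz =>
    pow_ne_zero 2 (one_sub_conj_mul_ne_zero (mem_ball_zero_iff.mp hz) hw)

theorem norm_inv_one_sub_conj_mul_sq_le {z w : ℂ} (hz : ‖z‖ < 1) (hw : ‖w‖ < 1) :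
    ‖((1 - conj z * w) ^ 2)⁻¹‖ ≤ ((1 - ‖w‖) ^ 2)⁻¹ := by
  rw [norm_inv, norm_pow]
  have h : 1 - ‖w‖ ≤ ‖1 - conj z * w‖ := by
    have := norm_sub_norm_le (1 : ℂ) (conj z * w)
    rw [norm_one, norm_mul, RCLike.norm_conj] at this
    nlinarith [norm_nonneg w, norm_nonneg z]
  have : 0 < 1 - ‖w‖ := by linarith
  gcongr

/-- The reproducing property of the Bergman kernel of the unit disc. -/
theorem setIntegral_ball_div_sq {g : ℂ → ℂ} (hg : DifferentiableOn ℂ g (Metric.ball 0 1))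
    (hi : IntegrableOn g (Metric.ball 0 1)) {w : ℂ} (hw : ‖w‖ < 1) :
    ∫ z in Metric.ball 0 1, g z / (1 - conj z * w) ^ 2 = Real.pi * g w := by
  have hc := continuousOn_div_sq hg.continuousOn hw
  have hi' : IntegrableOn (fun z => g z / (1 - conj z * w) ^ 2) (Metric.ball 0 1) := by
    simp only [div_eq_mul_inv]
    refine Integrable.mul_bdd (c := ((1 - ‖w‖) ^ 2)⁻¹) hi ?_ ?_
    · refine ContinuousOn.aestronglyMeasurable ?_ Metric.isOpen_ball.measurableSet
      exact ContinuousOn.inv₀ (by fun_prop) fun z hz =>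
        pow_ne_zero 2 (one_sub_conj_mul_ne_zero (mem_ball_zero_iff.mp hz) hw)
    · refine (ae_restrict_mem Metric.isOpen_ball.measurableSet).mono fun z hz => ?_
      exact norm_inv_one_sub_conj_mul_sq_le (mem_ball_zero_iff.mp hz) hw
  obtain ⟨hI, hE⟩ := setIntegral_ball_eq_polar hc hi'
  rw [hE]
  have hmem : ∀ r ∈ Set.Icc (0 : ℝ) 1, (r ^ 2 * w : ℂ) ∈ Metric.ball (0 : ℂ) 1 := by
    intro r hr
    rw [mem_ball_zero_iff, norm_mul, norm_pow, Complex.norm_real, Real.norm_of_nonneg hr.1]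
    nlinarith [norm_nonneg w, hr.1, hr.2, pow_le_one₀ (n := 2) hr.1 hr.2]
  -- The radial integrand has the explicit primitive π r² g(r²w).
  have hderiv : ∀ r ∈ Set.Ioo (0 : ℝ) 1,
      HasDerivAt (fun r : ℝ => Real.pi * ((r : ℂ) ^ 2 * g (r ^ 2 * w)))
        ((r : ℂ) * ∫ θ in (-Real.pi)..Real.pi, g (circleMap 0 r θ) /
          (1 - conj (circleMap 0 r θ) * w) ^ 2) r := by
    intro r hr
    rw [intervalIntegral_circleMap_div_sq hg hw hr.1 hr.2]
    have hsq : HasDerivAt (fun r : ℝ => (r : ℂ) ^ 2) (2 * r) r := by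
      simpa using ((hasDerivAt_id (r : ℂ)).pow 2).comp_ofReal
    have hgd := (hg.differentiableAt (Metric.isOpen_ball.mem_nhds
      (hmem r (Set.Ioo_subset_Icc_self hr)))).hasDerivAt
    have := ((hsq.mul (hgd.comp r (hsq.mul_const w))).const_mul (Real.pi : ℂ))
    refine this.congr_deriv ?_
    simp only [Function.comp]
    ring
  -- Since |w| < 1, the point r²w stays in the open disc even at r = 1, so the primitive is
  -- continuous up to the endpoint although g need not extend to the circle.
  have hcont : ContinuousOn (fun r : ℝ => Real.pi * ((r : ℂ) ^ 2 * g (r ^ 2 * w)))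
      (Set.Icc 0 1) :=
    continuousOn_const.mul ((by fun_prop : Continuous fun r : ℝ => (r : ℂ) ^ 2).continuousOn.mul
      (hg.continuousOn.comp (by fun_prop) hmem))
  have := intervalIntegral.integral_eq_sub_of_hasDerivAt_of_le zero_le_one hcont hderiv
    ((intervalIntegrable_iff_integrableOn_Ioo_of_le zero_le_one).mpr hI)
  rw [intervalIntegral.integral_of_le zero_le_one, integral_Ioc_eq_integral_Ioo] at this
  rw [this]
  simp


/-! ### The Bergman kernel of the bidisc -/

theorem aestronglyMeasurable_inv_one_sub_conj_mul_sq {w : ℂ} (hw : ‖w‖ < 1) :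
    AEStronglyMeasurable (fun z : ℂ => ((1 - conj z * w) ^ 2)⁻¹)
      (volume.restrict (Metric.ball 0 1)) := by
  refine ContinuousOn.aestronglyMeasurable ?_ Metric.isOpen_ball.measurableSet
  exact ContinuousOn.inv₀ (by fun_prop) fun z hz =>
    pow_ne_zero 2 (one_sub_conj_mul_ne_zero (mem_ball_zero_iff.mp hz) hw)

/-- The reproducing property of the Bergman kernel of the bidisc in `ℂ × ℂ`. -/
theorem setIntegral_ball_prod_ball {F : ℂ × ℂ → ℂ}
    (hF : DifferentiableOn ℂ F (Metric.ball 0 1 ×ˢ Metric.ball 0 1))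
    (hi : IntegrableOn F (Metric.ball 0 1 ×ˢ Metric.ball 0 1)) {w₁ w₂ : ℂ}
    (hw₁ : ‖w₁‖ < 1) (hw₂ : ‖w₂‖ < 1) :
    ∫ p in Metric.ball 0 1 ×ˢ Metric.ball 0 1,
        F p / ((1 - conj p.1 * w₁) ^ 2 * (1 - conj p.2 * w₂) ^ 2) =
      Real.pi ^ 2 * F (w₁, w₂) := by
  set m : Measure ℂ := volume.restrict (Metric.ball 0 1) with hm
  have hmem : ∀ᵐ z ∂m, ‖z‖ < 1 := (ae_restrict_mem Metric.isOpen_ball.measurableSet).mono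
    fun z hz => mem_ball_zero_iff.mp hz
  have hvol : volume.restrict ((Metric.ball 0 1 : Set ℂ) ×ˢ (Metric.ball 0 1 : Set ℂ)) =
      m.prod m := by
    rw [Measure.volume_eq_prod, hm, Measure.prod_restrict]
  rw [IntegrableOn, hvol] at hi
  rw [hvol]
  have h1 : Integrable (fun p : ℂ × ℂ => F p * ((1 - conj p.1 * w₁) ^ 2)⁻¹) (m.prod m) :=
    hi.mul_bdd (c := ((1 - ‖w₁‖) ^ 2)⁻¹)
      (aestronglyMeasurable_inv_one_sub_conj_mul_sq hw₁).comp_fst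
      ((Measure.quasiMeasurePreserving_fst.ae hmem).mono fun p hp =>
        norm_inv_one_sub_conj_mul_sq_le hp hw₁)
  have h2 : Integrable (fun p : ℂ × ℂ => F p * ((1 - conj p.1 * w₁) ^ 2)⁻¹ *
      ((1 - conj p.2 * w₂) ^ 2)⁻¹) (m.prod m) :=
    h1.mul_bdd (c := ((1 - ‖w₂‖) ^ 2)⁻¹)
      (aestronglyMeasurable_inv_one_sub_conj_mul_sq hw₂).comp_snd
      ((Measure.quasiMeasurePreserving_snd.ae hmem).mono fun p hp =>
        norm_inv_one_sub_conj_mul_sq_le hp hw₂)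
  have hinner : ∀ᵐ y ∂m, ∫ x, F (x, y) * ((1 - conj x * w₁) ^ 2)⁻¹ ∂m =
      Real.pi * F (w₁, y) := by
    filter_upwards [hi.prod_left_ae, hmem] with y hy hy1
    have hd : DifferentiableOn ℂ (fun x => F (x, y)) (Metric.ball 0 1) :=
      hF.comp (by fun_prop) fun x hx => ⟨hx, mem_ball_zero_iff.mpr hy1⟩
    simpa only [div_eq_mul_inv] using setIntegral_ball_div_sq hd hy hw₁
  -- Fubini gives integrability of almost every slice only, not of the slice at `w₁`. This one is
  -- integrable because it is a.e. a constant multiple of the inner integral.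
  have hslice : IntegrableOn (fun y => F (w₁, y)) (Metric.ball 0 1) := by
    have := (h1.integral_prod_right.congr hinner).const_mul ((Real.pi : ℂ)⁻¹)
    refine this.congr (Filter.Eventually.of_forall fun y => ?_)
    simp [Real.pi_ne_zero]
  have hslice' : DifferentiableOn ℂ (fun y => F (w₁, y)) (Metric.ball 0 1) :=
    hF.comp (by fun_prop) fun y hy => ⟨mem_ball_zero_iff.mpr hw₁, hy⟩
  calc ∫ p, F p / ((1 - conj p.1 * w₁) ^ 2 * (1 - conj p.2 * w₂) ^ 2) ∂m.prod m
      = ∫ p, F p * ((1 - conj p.1 * w₁) ^ 2)⁻¹ * ((1 - conj p.2 * w₂) ^ 2)⁻¹ ∂m.prod m := by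
        simp only [div_eq_mul_inv, mul_inv, mul_assoc]
    _ = ∫ y, (∫ x, F (x, y) * ((1 - conj x * w₁) ^ 2)⁻¹ ∂m) * ((1 - conj y * w₂) ^ 2)⁻¹ ∂m := by
        rw [integral_prod_symm _ h2]
        simp only [integral_mul_const]
    _ = ∫ y, Real.pi * (F (w₁, y) / (1 - conj y * w₂) ^ 2) ∂m := by
        refine integral_congr_ae (hinner.mono fun y hy => ?_)
        simp only [hy]
        ring
    _ = Real.pi ^ 2 * F (w₁, w₂) := by
        rw [integral_const_mul, hm, setIntegral_ball_div_sq hslice' hslice hw₂]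
        ring

theorem mem_polydisc_two {z : Fin 2 → ℂ} : z ∈ polydisc 2 ↔ ‖z 0‖ < 1 ∧ ‖z 1‖ < 1 := by
  rw [polydisc, mem_ball_zero_iff, pi_norm_lt_iff one_pos, Fin.forall_fin_two]

theorem isOpen_polydisc (n : ℕ) : IsOpen (polydisc n) := Metric.isOpen_ball

/-- For `lam = 2` the weight has exponent 0 and only the constant π⁻² remains. -/
theorem polydiscMeasure_two_two : polydiscMeasure 2 2 =
    ENNReal.ofReal ((1 / Real.pi) ^ 2) • volume.restrict (polydisc 2) := by
  rw [polydiscMeasure, ← withDensity_const]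
  congr 1
  funext z
  norm_num

theorem ae_mem_polydisc : ∀ᵐ z ∂(polydiscMeasure 2 2), z ∈ polydisc 2 := by
  rw [polydiscMeasure_two_two]
  exact Measure.ae_smul_measure (ae_restrict_mem (isOpen_polydisc 2).measurableSet) _

instance isFiniteMeasure_polydiscMeasure_two_two : IsFiniteMeasure (polydiscMeasure 2 2) := by
  rw [polydiscMeasure_two_two]
  have : IsFiniteMeasure (volume.restrict (polydisc 2)) :=
    ⟨by rw [Measure.restrict_apply_univ]; exact measure_ball_lt_top⟩
  exact Measure.smul_finite _ ENNReal.ofReal_ne_top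

theorem _root_.ContinuousOn.aestronglyMeasurable_polydiscMeasure {f : (Fin 2 → ℂ) → ℂ}
    (hf : ContinuousOn f (polydisc 2)) : AEStronglyMeasurable f (polydiscMeasure 2 2) := by
  rw [polydiscMeasure_two_two]
  exact (hf.aestronglyMeasurable (isOpen_polydisc 2).measurableSet).smul_measure _

/-- The conjugate of the Bergman kernel of the bidisc, `z ↦ conj k(z, w)`. -/
noncomputable def conjBergman (z w : Fin 2 → ℂ) : ℂ :=
  ((1 - conj (z 0) * w 0) ^ 2 * (1 - conj (z 1) * w 1) ^ 2)⁻¹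

theorem integral_mul_conjBergman {F : (Fin 2 → ℂ) → ℂ} (hF : DifferentiableOn ℂ F (polydisc 2))
    (hi : Integrable F (polydiscMeasure 2 2)) {w : Fin 2 → ℂ} (hw : w ∈ polydisc 2) :
    ∫ z, F z * conjBergman z w ∂(polydiscMeasure 2 2) = F w := by
  have hpi : (0 : ℝ) < (1 / Real.pi) ^ 2 := by positivity
  have hmp := volume_preserving_finTwoArrow ℂ
  have hpre : MeasurableEquiv.finTwoArrow (α := ℂ) ⁻¹'
      ((Metric.ball 0 1 : Set ℂ) ×ˢ (Metric.ball 0 1 : Set ℂ)) = polydisc 2 := by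
    ext z
    simp [mem_polydisc_two, MeasurableEquiv.finTwoArrow]
  have hcomp : ∀ z : Fin 2 → ℂ, ![z 0, z 1] = z := fun z => by
    funext i; fin_cases i <;> rfl
  rw [polydiscMeasure_two_two] at hi ⊢
  rw [integrable_smul_measure (by simp [Real.pi_pos.ne']) ENNReal.ofReal_ne_top] at hi
  rw [integral_smul_measure, ENNReal.toReal_ofReal hpi.le]
  have hemb := (MeasurableEquiv.finTwoArrow (α := ℂ)).measurableEmbedding
  have hG : DifferentiableOn ℂ (fun p : ℂ × ℂ => F ![p.1, p.2])
      (Metric.ball 0 1 ×ˢ Metric.ball 0 1) := by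
    refine hF.comp ?_ fun p hp => mem_polydisc_two.mpr
      ⟨mem_ball_zero_iff.mp hp.1, mem_ball_zero_iff.mp hp.2⟩
    refine Differentiable.differentiableOn (differentiable_pi.mpr fun i => ?_)
    fin_cases i
    · exact differentiable_fst
    · exact differentiable_snd
  have hGi : IntegrableOn (fun p : ℂ × ℂ => F ![p.1, p.2])
      (Metric.ball 0 1 ×ˢ Metric.ball 0 1) := by
    rw [← hmp.integrableOn_comp_preimage hemb, hpre]
    refine hi.congr (Filter.Eventually.of_forall fun z => ?_)
    change F z = F ![z 0, z 1]
    rw [hcomp]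
  obtain ⟨hw0, hw1⟩ := mem_polydisc_two.mp hw
  have key := setIntegral_ball_prod_ball hG hGi hw0 hw1
  rw [← hmp.setIntegral_preimage_emb hemb, hpre] at key
  have e : ∀ z : Fin 2 → ℂ, F z * conjBergman z w =
      (fun p : ℂ × ℂ => F ![p.1, p.2] / ((1 - conj p.1 * w 0) ^ 2 * (1 - conj p.2 * w 1) ^ 2))
        (MeasurableEquiv.finTwoArrow z) := fun z => by
    change _ = F ![z 0, z 1] / ((1 - conj (z 0) * w 0) ^ 2 * (1 - conj (z 1) * w 1) ^ 2)
    rw [hcomp, conjBergman, div_eq_mul_inv]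
  simp only [e]
  rw [key, hcomp, Complex.real_smul]
  push_cast
  have : (Real.pi : ℂ) ≠ 0 := by exact_mod_cast Real.pi_ne_zero
  field_simp


/-! ### The symmetrization map and the candidate kernel -/

theorem symmetrization_two (z : Fin 2 → ℂ) : symmetrization 2 z = ![z 0 + z 1, z 0 * z 1] := by
  have h1 : Finset.powersetCard 1 (Finset.univ : Finset (Fin 2)) = {{0}, {1}} := by decide
  have h2 : Finset.powersetCard 2 (Finset.univ : Finset (Fin 2)) = {{0, 1}} := by decide
  funext i
  fin_cases i <;>
    simp [symmetrization, MvPolynomial.esymm, h1, h2]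

theorem symmetrization_two_zero (z : Fin 2 → ℂ) : symmetrization 2 z 0 = z 0 + z 1 := by
  rw [symmetrization_two]; rfl

theorem symmetrization_two_one (z : Fin 2 → ℂ) : symmetrization 2 z 1 = z 0 * z 1 := by
  rw [symmetrization_two]; rfl

theorem jacobian_two (z : Fin 2 → ℂ) : jacobian 2 z = z 0 - z 1 := by
  have h0 : Finset.Ioi (0 : Fin 2) = {1} := by decide
  have h1 : Finset.Ioi (1 : Fin 2) = ∅ := by decide
  simp [jacobian, Fin.prod_univ_two, h0, h1]

theorem differentiable_symmetrization : Differentiable ℂ (symmetrization 2) := by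
  refine differentiable_pi.mpr fun i => ?_
  fin_cases i
  · simp only [Fin.zero_eta, symmetrization_two_zero]; fun_prop
  · simp only [Fin.mk_one, symmetrization_two_one]; fun_prop

theorem differentiable_jacobian : Differentiable ℂ (jacobian 2) := by
  rw [show jacobian 2 = fun z => z 0 - z 1 from funext jacobian_two]
  fun_prop

/-- The polynomial whose square is the denominator of the Bergman kernel of `𝔾₂`. -/
noncomputable def kernelDenom (u v : Fin 2 → ℂ) : ℂ :=
  (1 - u 1 * conj (v 1)) ^ 2 - (u 0 - u 1 * conj (v 0)) * (conj (v 0) - conj (v 1) * u 0)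

/-- The Bergman kernel of the symmetrized bidisc. -/
noncomputable def symKernel (u v : Fin 2 → ℂ) : ℂ :=
  (1 / 2) * ((2 * (1 + u 1 * conj (v 1)) - u 0 * conj (v 0)) / kernelDenom u v ^ 2)

theorem conj_symKernel (u v : Fin 2 → ℂ) : conj (symKernel u v) = symKernel v u := by
  simp only [symKernel, kernelDenom, map_mul, map_div₀, map_sub, map_add, map_pow, map_one,
    map_ofNat, Complex.conj_conj]
  congr 2 <;> ring

/-- This factorization gives non-vanishing on 𝔾₂ × 𝔾₂ as well as the link with the bidisc kernel. -/
theorem kernelDenom_symmetrization (z w : Fin 2 → ℂ) :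
    kernelDenom (symmetrization 2 z) (symmetrization 2 w) =
      ((1 - conj (w 0) * z 0) * (1 - conj (w 1) * z 1)) *
        ((1 - conj (w 0) * z 1) * (1 - conj (w 1) * z 0)) := by
  simp only [kernelDenom, symmetrization_two_zero, symmetrization_two_one, map_add, map_mul]
  ring

theorem kernelDenom_ne_zero {u v : Fin 2 → ℂ} (hu : u ∈ symPolydisc 2) (hv : v ∈ symPolydisc 2) :
    kernelDenom u v ≠ 0 := by
  obtain ⟨z, hz, rfl⟩ := hu
  obtain ⟨w, hw, rfl⟩ := hv
  rw [mem_polydisc_two] at hz hw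
  rw [kernelDenom_symmetrization]
  exact mul_ne_zero
    (mul_ne_zero (one_sub_conj_mul_ne_zero hw.1 hz.1) (one_sub_conj_mul_ne_zero hw.2 hz.2))
    (mul_ne_zero (one_sub_conj_mul_ne_zero hw.1 hz.2) (one_sub_conj_mul_ne_zero hw.2 hz.1))

theorem symKernel_symmetrization (z w : Fin 2 → ℂ) :
    symKernel (symmetrization 2 z) (symmetrization 2 w) =
      (1 / 2) * (((1 - conj (w 0) * z 0) * (1 - conj (w 1) * z 1) +
        (1 - conj (w 0) * z 1) * (1 - conj (w 1) * z 0)) /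
      (((1 - conj (w 0) * z 0) * (1 - conj (w 1) * z 1)) *
        ((1 - conj (w 0) * z 1) * (1 - conj (w 1) * z 0))) ^ 2) := by
  rw [symKernel, kernelDenom_symmetrization]
  congr 2
  simp only [symmetrization_two_zero, symmetrization_two_one, map_add, map_mul]
  ring

/-- The bound is uniform in z, which gives both square integrability and a dominating function. The
exponent 8 counts four factors of modulus at least 1 - ρ, squared; the 4 is half of 2·2 + 2·2. -/
theorem norm_symKernel_le {z w : Fin 2 → ℂ} {ρ : ℝ} (hρ : ρ < 1) (hz : z ∈ polydisc 2)
    (hw : ∀ i, ‖w i‖ ≤ ρ) :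
    ‖symKernel (symmetrization 2 z) (symmetrization 2 w)‖ ≤ 4 / (1 - ρ) ^ 8 := by
  have hz' : ∀ i, ‖z i‖ < 1 := (pi_norm_lt_iff one_pos).mp (mem_ball_zero_iff.mp hz)
  have hρ' : 0 < 1 - ρ := by linarith
  have hwz : ∀ i j, ‖conj (w i) * z j‖ ≤ ρ := by
    intro i j
    rw [norm_mul, RCLike.norm_conj]
    nlinarith [norm_nonneg (w i), norm_nonneg (z j), hw i, hz' j]
  have lower : ∀ i j, 1 - ρ ≤ ‖1 - conj (w i) * z j‖ := by
    intro i j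
    have := norm_sub_norm_le (1 : ℂ) (conj (w i) * z j)
    rw [norm_one] at this
    linarith [hwz i j]
  have upper : ∀ i j, ‖1 - conj (w i) * z j‖ ≤ 2 := by
    intro i j
    have := norm_sub_le (1 : ℂ) (conj (w i) * z j)
    rw [norm_one] at this
    linarith [hwz i j]
  rw [symKernel_symmetrization, norm_mul, norm_div (_ + _), norm_pow]
  have hnum : ‖(1 - conj (w 0) * z 0) * (1 - conj (w 1) * z 1) +
      (1 - conj (w 0) * z 1) * (1 - conj (w 1) * z 0)‖ ≤ 8 := by
    refine (norm_add_le _ _).trans ?_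
    rw [norm_mul, norm_mul]
    calc _ ≤ (2 : ℝ) * 2 + 2 * 2 := by gcongr <;> exact upper _ _
      _ = 8 := by norm_num
  have hden : (1 - ρ) ^ 8 ≤ ‖(1 - conj (w 0) * z 0) * (1 - conj (w 1) * z 1) *
      ((1 - conj (w 0) * z 1) * (1 - conj (w 1) * z 0))‖ ^ 2 := by
    simp only [norm_mul]
    calc (1 - ρ) ^ 8 = ((1 - ρ) * (1 - ρ) * ((1 - ρ) * (1 - ρ))) ^ 2 := by ring
      _ ≤ _ := by gcongr <;> exact lower _ _
  calc _ ≤ ‖(1 / 2 : ℂ)‖ * (8 / (1 - ρ) ^ 8) := by gcongr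
    _ = _ := by norm_num; ring

theorem jacobian_mul_conj_symKernel {z w : Fin 2 → ℂ} (hz : z ∈ polydisc 2)
    (hw : w ∈ polydisc 2) :
    jacobian 2 w * conj (symKernel (symmetrization 2 z) (symmetrization 2 w) * jacobian 2 z) =
      (1 / 2) * (conjBergman z w - conjBergman z ![w 1, w 0]) := by
  rw [mem_polydisc_two] at hz hw
  have h00 := one_sub_conj_mul_ne_zero hz.1 hw.1
  have h01 := one_sub_conj_mul_ne_zero hz.1 hw.2
  have h10 := one_sub_conj_mul_ne_zero hz.2 hw.1
  have h11 := one_sub_conj_mul_ne_zero hz.2 hw.2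
  rw [map_mul, conj_symKernel, symKernel_symmetrization, jacobian_two, jacobian_two, conjBergman,
    conjBergman]
  simp only [map_sub, Matrix.cons_val_zero, Matrix.cons_val_one]
  -- This is bc - ad, the factor that turns the kernel's numerator ad + bc into (bc)² - (ad)².
  have e : (w 0 - w 1) * (conj (z 0) - conj (z 1)) =
      (1 - conj (z 0) * w 1) * (1 - conj (z 1) * w 0) -
        (1 - conj (z 0) * w 0) * (1 - conj (z 1) * w 1) := by ring
  have e' : ∀ x y q : ℂ, x * (1 / 2 * q * y) = 1 / 2 * (q * (x * y)) := fun x y q => by ring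
  rw [e', e]
  generalize 1 - conj (z 0) * w 0 = a at *
  generalize 1 - conj (z 0) * w 1 = b at *
  generalize 1 - conj (z 1) * w 0 = c at *
  generalize 1 - conj (z 1) * w 1 = d at *
  field_simp
  ring

/-! ### The reproducing property pulled back to the bidisc -/

theorem differentiableOn_comp_mul_jacobian {f : (Fin 2 → ℂ) → ℂ}
    (hf : DifferentiableOn ℂ f (symPolydisc 2)) :
    DifferentiableOn ℂ (fun z => f (symmetrization 2 z) * jacobian 2 z) (polydisc 2) :=
  (hf.comp differentiable_symmetrization.differentiableOn
    fun _ hz => Set.mem_image_of_mem _ hz).mul differentiable_jacobian.differentiableOn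

theorem continuous_jacobian : Continuous (jacobian 2) := differentiable_jacobian.continuous

theorem continuous_symmetrization : Continuous (symmetrization 2) :=
  differentiable_symmetrization.continuous

theorem differentiableOn_symKernel_left {v : Fin 2 → ℂ} (hv : v ∈ symPolydisc 2) :
    DifferentiableOn ℂ (fun u => symKernel u v) (symPolydisc 2) := by
  unfold symKernel
  have hden : Differentiable ℂ fun u => kernelDenom u v := by
    unfold kernelDenom
    fun_prop
  have hnum : Differentiable ℂ fun u : Fin 2 → ℂ =>
      2 * (1 + u 1 * conj (v 1)) - u 0 * conj (v 0) := by fun_prop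
  simp only [div_eq_mul_inv]
  exact (hnum.differentiableOn.mul ((hden.pow 2).differentiableOn.inv fun u hu =>
    pow_ne_zero 2 (kernelDenom_ne_zero hu hv))).const_mul _

/-- Hermitian symmetry transfers holomorphy in the first variable to continuity in the second. -/
theorem continuousOn_symKernel_right {u : Fin 2 → ℂ} (hu : u ∈ symPolydisc 2) :
    ContinuousOn (symKernel u) (symPolydisc 2) := by
  refine (Complex.continuous_conj.comp_continuousOn
    (differentiableOn_symKernel_left hu).continuousOn).congr fun v _ => ?_
  exact (conj_symKernel v u).symm

theorem norm_jacobian_le {z : Fin 2 → ℂ} (hz : z ∈ polydisc 2) : ‖jacobian 2 z‖ ≤ 2 := by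
  rw [mem_polydisc_two] at hz
  rw [jacobian_two]
  linarith [norm_sub_le (z 0) (z 1)]

theorem aestronglyMeasurable_kernel_mul_jacobian {w : Fin 2 → ℂ} (hw : w ∈ polydisc 2) :
    AEStronglyMeasurable (fun z => conj (symKernel (symmetrization 2 z) (symmetrization 2 w) *
      jacobian 2 z)) (polydiscMeasure 2 2) :=
  (Complex.continuous_conj.comp_continuousOn (differentiableOn_comp_mul_jacobian
    (differentiableOn_symKernel_left ⟨w, hw, rfl⟩)).continuousOn).aestronglyMeasurable_polydiscMeasure

/-- After multiplication by J(w), the kernel is the antisymmetrized bidisc kernel. It returns (F(w)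
- F(w'))/2 = F(w) = f(s(w))·J(w), since F = (f ∘ s)·J is antisymmetric, and J(w) cancels. -/
theorem integral_kernel_of_jacobian_ne_zero {f : (Fin 2 → ℂ) → ℂ}
    (hf : DifferentiableOn ℂ f (symPolydisc 2))
    (hi : Integrable (fun z => f (symmetrization 2 z) * jacobian 2 z) (polydiscMeasure 2 2))
    {w : Fin 2 → ℂ} (hw : w ∈ polydisc 2) (hJ : jacobian 2 w ≠ 0) :
    ∫ z, f (symmetrization 2 z) * jacobian 2 z *
      conj (symKernel (symmetrization 2 z) (symmetrization 2 w) * jacobian 2 z)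
        ∂(polydiscMeasure 2 2) = f (symmetrization 2 w) := by
  set F : (Fin 2 → ℂ) → ℂ := fun z => f (symmetrization 2 z) * jacobian 2 z with hFdef
  have hF := differentiableOn_comp_mul_jacobian hf
  have hw' : ![w 1, w 0] ∈ polydisc 2 := by
    rw [mem_polydisc_two] at hw ⊢
    exact ⟨hw.2, hw.1⟩
  have hFw : F ![w 1, w 0] = -F w := by
    have hs : symmetrization 2 ![w 1, w 0] = symmetrization 2 w := by
      rw [symmetrization_two, symmetrization_two]
      simp [add_comm, mul_comm]
    simp only [hFdef, hs, jacobian_two, Matrix.cons_val_zero, Matrix.cons_val_one]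
    ring
  have hbdd : ∀ w' ∈ polydisc 2, Integrable (fun z => F z * conjBergman z w')
      (polydiscMeasure 2 2) := by
    intro w' hw'
    rw [mem_polydisc_two] at hw'
    refine hi.mul_bdd (c := ((1 - ‖w' 0‖) ^ 2)⁻¹ * ((1 - ‖w' 1‖) ^ 2)⁻¹) ?_ ?_
    · refine ContinuousOn.aestronglyMeasurable_polydiscMeasure ?_
      unfold conjBergman
      refine ContinuousOn.inv₀ (by fun_prop) fun z hz => ?_
      rw [mem_polydisc_two] at hz
      exact mul_ne_zero (pow_ne_zero 2 (one_sub_conj_mul_ne_zero hz.1 hw'.1))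
        (pow_ne_zero 2 (one_sub_conj_mul_ne_zero hz.2 hw'.2))
    · filter_upwards [ae_mem_polydisc] with z hz
      rw [mem_polydisc_two] at hz
      rw [conjBergman, mul_inv, norm_mul]
      gcongr
      · exact norm_inv_one_sub_conj_mul_sq_le hz.1 hw'.1
      · exact norm_inv_one_sub_conj_mul_sq_le hz.2 hw'.2
  refine mul_left_cancel₀ hJ ?_
  rw [← integral_const_mul]
  calc _ = ∫ z, (1 / 2) * (F z * conjBergman z w - F z * conjBergman z ![w 1, w 0])
        ∂(polydiscMeasure 2 2) := by
        refine integral_congr_ae ?_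
        filter_upwards [ae_mem_polydisc] with z hz
        have := jacobian_mul_conj_symKernel hz hw
        rw [mul_left_comm, this]
        ring
    _ = F w := by
        rw [integral_const_mul, integral_sub (hbdd _ hw) (hbdd _ hw'),
          integral_mul_conjBergman hF hi hw, integral_mul_conjBergman hF hi hw']
        change 1 / 2 * (F w - F ![w 1, w 0]) = F w
        rw [hFw]
        ring
    _ = _ := mul_comm _ _

/-- The reproducing property of `symKernel`, pulled back to the bidisc. -/
theorem integral_kernel {f : (Fin 2 → ℂ) → ℂ}
    (hf : DifferentiableOn ℂ f (symPolydisc 2))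
    (hi : Integrable (fun z => f (symmetrization 2 z) * jacobian 2 z) (polydiscMeasure 2 2))
    {w : Fin 2 → ℂ} (hw : w ∈ polydisc 2) :
    ∫ z, f (symmetrization 2 z) * jacobian 2 z *
      conj (symKernel (symmetrization 2 z) (symmetrization 2 w) * jacobian 2 z)
        ∂(polydiscMeasure 2 2) = f (symmetrization 2 w) := by
  by_cases hJ : jacobian 2 w = 0
  swap
  · exact integral_kernel_of_jacobian_ne_zero hf hi hw hJ
  obtain ⟨ρ, hwρ, hρ⟩ := exists_between (mem_ball_zero_iff.mp hw)
  -- Here w lies on the diagonal. Moving its first coordinate by t makes the Jacobian equal to t,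
  -- hence non-zero, and t → 0 recovers w; `ρ` keeps the nearby points in a fixed smaller bidisc.
  set wt : ℂ → Fin 2 → ℂ := fun t => w + ![t, 0] with hwt
  have hwtc : Continuous wt := by
    refine continuous_const.add (continuous_pi fun i => ?_)
    fin_cases i
    · exact continuous_id
    · exact continuous_const
  have hwt0 : wt 0 = w := by
    funext i; fin_cases i <;> exact add_zero _
  have hlim : Filter.Tendsto wt (𝓝[≠] 0) (𝓝 w) := by
    have := hwtc.tendsto 0
    rw [hwt0] at this
    exact this.mono_left nhdsWithin_le_nhds
  have hlims : Filter.Tendsto (fun t => symmetrization 2 (wt t)) (𝓝[≠] 0)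
      (𝓝 (symmetrization 2 w)) := (continuous_symmetrization.tendsto w).comp hlim
  have hev : ∀ᶠ t in 𝓝[≠] (0 : ℂ), ‖wt t‖ < ρ := hlim.norm.eventually_lt_const hwρ
  have hmem : ∀ {t}, ‖wt t‖ < ρ → wt t ∈ polydisc 2 := fun h =>
    mem_ball_zero_iff.mpr (h.trans hρ)
  have hlimG : Filter.Tendsto (fun t => symmetrization 2 (wt t)) (𝓝[≠] 0)
      (𝓝[symPolydisc 2] (symmetrization 2 w)) :=
    tendsto_nhdsWithin_iff.mpr ⟨hlims, hev.mono fun t ht => ⟨_, hmem ht, rfl⟩⟩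
  have hwG : symmetrization 2 w ∈ symPolydisc 2 := ⟨w, hw, rfl⟩
  have h1 : Filter.Tendsto (fun t => f (symmetrization 2 (wt t))) (𝓝[≠] 0)
      (𝓝 (f (symmetrization 2 w))) := (hf.continuousOn _ hwG).tendsto.comp hlimG
  have h2 : Filter.Tendsto (fun t => ∫ z, f (symmetrization 2 z) * jacobian 2 z *
      conj (symKernel (symmetrization 2 z) (symmetrization 2 (wt t)) * jacobian 2 z)
        ∂(polydiscMeasure 2 2)) (𝓝[≠] 0) (𝓝 (∫ z, f (symmetrization 2 z) * jacobian 2 z *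
      conj (symKernel (symmetrization 2 z) (symmetrization 2 w) * jacobian 2 z)
        ∂(polydiscMeasure 2 2))) := by
    refine tendsto_integral_filter_of_dominated_convergence
      (fun z => ‖f (symmetrization 2 z) * jacobian 2 z‖ * (4 / (1 - ρ) ^ 8 * 2)) ?_ ?_
      (hi.norm.mul_const _) ?_
    · exact hev.mono fun t ht => hi.aestronglyMeasurable.mul
        (aestronglyMeasurable_kernel_mul_jacobian (hmem ht))
    · refine hev.mono fun t ht => ?_
      filter_upwards [ae_mem_polydisc] with z hz
      have h8 : 0 < (1 - ρ) ^ 8 := pow_pos (by linarith) 8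
      rw [norm_mul, RCLike.norm_conj, norm_mul (symKernel _ _)]
      gcongr
      · exact norm_symKernel_le hρ hz fun i => (norm_le_pi_norm _ i).trans ht.le
      · exact norm_jacobian_le hz
    · filter_upwards [ae_mem_polydisc] with z hz
      refine Filter.Tendsto.const_mul _ ((Complex.continuous_conj.tendsto _).comp
        (Filter.Tendsto.mul_const _ ?_))
      exact (continuousOn_symKernel_right ⟨z, hz, rfl⟩ _ hwG).tendsto.comp hlimG
  refine tendsto_nhds_unique (h2.congr' ?_) h1
  filter_upwards [hev, self_mem_nhdsWithin] with t ht ht0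
  refine integral_kernel_of_jacobian_ne_zero hf hi (hmem ht) ?_
  rw [jacobian_two, sub_eq_zero] at hJ
  have e : wt t 0 - wt t 1 = t := by
    change w 0 + t - (w 1 + 0) = t
    rw [hJ]
    ring
  rw [jacobian_two, e]
  exact ht0


/-! ### Transfer to the symmetrized bidisc and uniqueness -/

/-- Openness of 𝔾₂ is not required: the bidisc is σ-compact, so its continuous image is a countable
union of compact sets. -/
theorem measurableSet_symPolydisc : MeasurableSet (symPolydisc 2) := by
  have : LocallyCompactSpace (polydisc 2) := (isOpen_polydisc 2).locallyCompactSpace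
  have hσ : IsSigmaCompact (symPolydisc 2) :=
    (isSigmaCompact_iff_sigmaCompactSpace.mpr inferInstance :
      IsSigmaCompact (polydisc 2)).image continuous_symmetrization
  obtain ⟨C, hC, hU⟩ := hσ
  rw [← hU]
  exact MeasurableSet.iUnion fun n => (hC n).measurableSet

theorem integrable_jacobian : Integrable (jacobian 2) (polydiscMeasure 2 2) :=
  Integrable.of_bound continuous_jacobian.aestronglyMeasurable 2
    (ae_mem_polydisc.mono fun _ hz => norm_jacobian_le hz)

/-- No direct integration: the kernel at v = 0 is identically 1, so reproducing the constant 1 at 0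
says ∫ |J|² dV = 1. -/
theorem jacobianNormSq_two_two : jacobianNormSq 2 2 = 1 := by
  have h0 : (0 : Fin 2 → ℂ) ∈ polydisc 2 := Metric.mem_ball_self one_pos
  have hs0 : symmetrization 2 0 = 0 := by
    rw [symmetrization_two]
    funext i; fin_cases i <;> simp
  have hK : ∀ u, symKernel u 0 = 1 := fun u => by simp [symKernel, kernelDenom]
  have h := integral_kernel (f := fun _ => 1) (differentiableOn_const _)
    (by simpa using integrable_jacobian) h0
  simp only [hs0, hK, one_mul, Complex.mul_conj, Complex.normSq_eq_norm_sq] at h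
  have h' : ∫ z, ‖jacobian 2 z‖ ^ 2 ∂(polydiscMeasure 2 2) = 1 := by
    rw [integral_complex_ofReal] at h
    exact_mod_cast h
  -- A non-integrable function would have integral 0 by convention, contradicting the value 1.
  have hi : Integrable (fun z => ‖jacobian 2 z‖ ^ 2) (polydiscMeasure 2 2) := by
    by_contra hn
    rw [integral_undef hn] at h'
    exact zero_ne_one h'
  have := ofReal_integral_eq_lintegral_ofReal hi
    (Filter.Eventually.of_forall fun z => by positivity)
  rw [h', ENNReal.ofReal_one] at this
  rw [jacobianNormSq, this]
  refine lintegral_congr fun z => ?_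
  rw [ENNReal.ofReal_pow (norm_nonneg _), ofReal_norm]

theorem symMeasure_two_two : symMeasure 2 2 =
    ((polydiscMeasure 2 2).withDensity fun z => ‖jacobian 2 z‖ₑ ^ 2).map (symmetrization 2) := by
  rw [symMeasure, jacobianNormSq_two_two, inv_one, one_smul]

theorem measurable_enorm_jacobian_sq : Measurable fun z : Fin 2 → ℂ => ‖jacobian 2 z‖ₑ ^ 2 :=
  continuous_jacobian.measurable.enorm.pow_const 2

theorem toReal_enorm_sq (x : ℂ) : (‖x‖ₑ ^ 2).toReal = ‖x‖ ^ 2 := by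
  rw [ENNReal.toReal_pow, toReal_enorm]

instance isFiniteMeasure_symMeasure_two_two : IsFiniteMeasure (symMeasure 2 2) := by
  rw [symMeasure_two_two]
  have : IsFiniteMeasure ((polydiscMeasure 2 2).withDensity fun z => ‖jacobian 2 z‖ₑ ^ 2) := by
    refine isFiniteMeasure_withDensity ?_
    rw [← jacobianNormSq, jacobianNormSq_two_two]
    exact ENNReal.one_ne_top
  infer_instance

theorem ae_mem_symPolydisc : ∀ᵐ u ∂(symMeasure 2 2), u ∈ symPolydisc 2 := by
  rw [symMeasure_two_two]
  refine (ae_map_iff continuous_symmetrization.aemeasurable measurableSet_symPolydisc).mpr ?_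
  exact (withDensity_absolutelyContinuous _ _).ae_le
    (ae_mem_polydisc.mono fun z hz => Set.mem_image_of_mem _ hz)

theorem ae_enorm_jacobian_sq_lt_top :
    ∀ᵐ z ∂(polydiscMeasure 2 2), ‖jacobian 2 z‖ₑ ^ 2 < ∞ :=
  Filter.Eventually.of_forall fun _ => ENNReal.pow_lt_top enorm_lt_top

theorem integral_symMeasure {g : (Fin 2 → ℂ) → ℂ}
    (hg : AEStronglyMeasurable g (symMeasure 2 2)) :
    ∫ u, g u ∂(symMeasure 2 2) =
      ∫ z, (‖jacobian 2 z‖ ^ 2) • g (symmetrization 2 z) ∂(polydiscMeasure 2 2) := by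
  rw [symMeasure_two_two] at hg ⊢
  rw [integral_map continuous_symmetrization.aemeasurable hg,
    integral_withDensity_eq_integral_toReal_smul measurable_enorm_jacobian_sq
      ae_enorm_jacobian_sq_lt_top]
  simp only [toReal_enorm_sq]

/-- Square integrability of f on 𝔾₂ is that of (f ∘ s)·J on the bidisc, and the measure there is
finite, so L² lies in L¹. -/
theorem integrable_comp_mul_jacobian {f : (Fin 2 → ℂ) → ℂ} (hf : f ∈ weightedBergman 2 2) :
    Integrable (fun z => f (symmetrization 2 z) * jacobian 2 z) (polydiscMeasure 2 2) := by
  obtain ⟨hd, hL⟩ := hf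
  have hm := (differentiableOn_comp_mul_jacobian hd).continuousOn.aestronglyMeasurable_polydiscMeasure
  refine MemLp.integrable one_le_two ((memLp_two_iff_integrable_sq_norm hm).mpr ?_)
  rw [symMeasure_two_two] at hL
  have h2 := hL.comp_of_map continuous_symmetrization.aemeasurable
  have h3 := (memLp_two_iff_integrable_sq_norm h2.aestronglyMeasurable).mp h2
  rw [integrable_withDensity_iff_integrable_smul' measurable_enorm_jacobian_sq
    ae_enorm_jacobian_sq_lt_top] at h3
  refine h3.congr (Filter.Eventually.of_forall fun z => ?_)
  simp only [toReal_enorm_sq, Function.comp, norm_mul, smul_eq_mul]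
  ring

theorem aestronglyMeasurable_symMeasure {g : (Fin 2 → ℂ) → ℂ}
    (hg : ContinuousOn g (symPolydisc 2)) : AEStronglyMeasurable g (symMeasure 2 2) := by
  rw [← Measure.restrict_eq_self_of_ae_mem ae_mem_symPolydisc]
  exact hg.aestronglyMeasurable measurableSet_symPolydisc

theorem symKernel_mem_weightedBergman {v : Fin 2 → ℂ} (hv : v ∈ symPolydisc 2) :
    (fun u => symKernel u v) ∈ weightedBergman 2 2 := by
  have hd := differentiableOn_symKernel_left hv
  obtain ⟨w, hw, rfl⟩ := hv
  refine ⟨hd, MemLp.of_bound (aestronglyMeasurable_symMeasure hd.continuousOn)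
    (4 / (1 - ‖w‖) ^ 8) (ae_mem_symPolydisc.mono ?_)⟩
  rintro _ ⟨z, hz, rfl⟩
  exact norm_symKernel_le (mem_ball_zero_iff.mp hw) hz (norm_le_pi_norm w)

theorem isBergmanKernel_symKernel : IsBergmanKernel 2 2 symKernel := by
  intro v hv
  refine ⟨symKernel_mem_weightedBergman hv, fun f hf => ?_⟩
  have hK := symKernel_mem_weightedBergman hv
  have hm : AEStronglyMeasurable (fun u => f u * conj (symKernel u v)) (symMeasure 2 2) :=
    hf.2.aestronglyMeasurable.mul
      (Complex.continuous_conj.comp_aestronglyMeasurable hK.2.aestronglyMeasurable)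
  rw [integral_symMeasure hm]
  obtain ⟨w, hw, rfl⟩ := hv
  rw [← integral_kernel hf.1 (integrable_comp_mul_jacobian hf) hw]
  refine integral_congr_ae (Filter.Eventually.of_forall fun z => ?_)
  have : ((‖jacobian 2 z‖ ^ 2 : ℝ) : ℂ) = jacobian 2 z * conj (jacobian 2 z) := by
    rw [Complex.mul_conj, Complex.normSq_eq_norm_sq]
  simp only [Complex.real_smul, this, map_mul]
  ring

/-- Two reproducing kernels `K`, `L` of the same space satisfy `K u v = conj (L v u)`. -/
theorem IsBergmanKernel.eq_conj {n : ℕ} {lam : ℝ} {K L : (Fin n → ℂ) → (Fin n → ℂ) → ℂ}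
    (hK : IsBergmanKernel n lam K) (hL : IsBergmanKernel n lam L) {u v : Fin n → ℂ}
    (hu : u ∈ symPolydisc n) (hv : v ∈ symPolydisc n) : K u v = conj (L v u) := by
  rw [← (hL u hu).2 _ (hK v hv).1, ← (hK v hv).2 _ (hL u hu).1, ← integral_conj]
  refine integral_congr_ae (Filter.Eventually.of_forall fun x => ?_)
  simp only [map_mul, Complex.conj_conj]
  ring

/-- Values off 𝔾₂ do not matter, because `symMeasure 2 2` is carried by 𝔾₂. -/
theorem IsBergmanKernel.congr {K L : (Fin 2 → ℂ) → (Fin 2 → ℂ) → ℂ}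
    (hL : IsBergmanKernel 2 2 L)
    (h : ∀ u ∈ symPolydisc 2, ∀ v ∈ symPolydisc 2, K u v = L u v) : IsBergmanKernel 2 2 K := by
  intro v hv
  obtain ⟨⟨hd, hm⟩, hrep⟩ := hL v hv
  have hae : ∀ᵐ u ∂(symMeasure 2 2), K u v = L u v :=
    ae_mem_symPolydisc.mono fun u hu => h u hu v hv
  refine ⟨⟨hd.congr fun u hu => h u hu v hv,
    (memLp_congr_ae hae).mpr hm⟩, fun f hf => ?_⟩
  rw [← hrep f hf]
  exact integral_congr_ae (hae.mono fun u hu => by simp only [hu])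

end SymPolydisc


theorem mainTheorem4 (K : (Fin 2 → ℂ) → (Fin 2 → ℂ) → ℂ) :
    SymPolydisc.IsBergmanKernel 2 2 K ↔
      ∀ u ∈ SymPolydisc.symPolydisc 2, ∀ v ∈ SymPolydisc.symPolydisc 2,
        (1 - u 1 * conj (v 1)) ^ 2
            - (u 0 - u 1 * conj (v 0)) * (conj (v 0) - conj (v 1) * u 0) ≠ 0 ∧
        K u v = (1 / 2) *
          ((2 * (1 + u 1 * conj (v 1)) - u 0 * conj (v 0)) /
            ((1 - u 1 * conj (v 1)) ^ 2
              - (u 0 - u 1 * conj (v 0)) * (conj (v 0) - conj (v 1) * u 0)) ^ 2) := by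
  refine ⟨fun hK u hu v hv => ⟨SymPolydisc.kernelDenom_ne_zero hu hv, ?_⟩, fun h => ?_⟩
  · rw [hK.eq_conj SymPolydisc.isBergmanKernel_symKernel hu hv, SymPolydisc.conj_symKernel]
    rfl
  · exact SymPolydisc.isBergmanKernel_symKernel.congr fun u hu v hv => (h u hu v hv).2
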